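/- Let $d\ge 1$ and $M\ge 2$ be integers, $r:=1/M$, $p\in(0,1]$, $D:=\log(M^dp)/\log M$, and $k\in\{0,\dots,d\}$. For a polyconvex set $K\subset\mathbb R^d$ (a finite union of compact convex sets) let $C_k(K,\cdot)$ be its $k$-th curvature measure, i.e. the additive extension to polyconvex sets of the measures that are defined for compact convex $K$ by the local Steiner formula $$\lambda_d\big(\{x:\ \mathrm{dist}(x,K)\le\varepsilon,\ \pi_K(x)\in B\}\big)=\sum_{k=0}^d \varepsilon^{d-k}\kappa_{d-k}\,C_k(K,B)\qquad(\varepsilon>0,\ B \text{ Borel}),$$ where $\pi_K$ is the metric projection onto $K$ and $\kappa_j$ is the volume of the unit ball of $\mathbb R^j$. Let $C_k^{\mathsf{var}}(K)$ be the total mass of the total variation measure of $C_k(K,\cdot)$, and $V_k(K):=C_k(K,\mathbb R^d)$ the $k$-th intrinsic volume. A fractal percolation on $[0,1]^d$ with parameters $M$ and $p$ is constructed as follows: start with $F_0:=[0,1]^d$; in step $n\ge1$ divide each cube kept in step $n-1$ (for $n=1$: the unit cube) into $M^d$ closed subcubes of side length $r^n$, and keep each of these with probability $p$, independently of all other choices;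 $F_n$ is the union of the cubes kept in step $n$. Let $J_1,\dots,J_{M^d}$ be the closed cubes of side length $r$ into which $[0,1]^d$ is divided in the first step. For $n\ge1$, let $F_n^j$ be the union of the cubes kept in step $n$ that are contained in $J_j$, and $C_n^j$ the union of those closed level-$n$ subcubes of $J_j$ that are not kept (i.e. that are themselves discarded or are contained in a cube discarded earlier). 1. Suppose $p>\max\{r^3,r^d\}$. Let $\ell\ge2$ and let $F^{(1)},\dots,F^{(\ell)}$ be independent fractal percolations on $[0,1]^d$ with parameters $M$ and $p$, with $n$-th approximations $F^{(1)}_n,\dots,F_n^{(\ell)}$. Then there are constants $c>0$ and $0<\gamma<1$, depending only on $d,M,p,k,\ell$, such that for all $n\ge1$ $$\mathbb E\, C_k^{\mathsf{var}}\big(F_n^{(1)}\cap\dots\cap F_n^{(\ell)}\big)\le c\,r^{(k-d-1)n}\,p^n\,\gamma^n .$$ 2. Suppose $p>M^{-\min\{3,d\}}$. Then for every $T\subset\{1,\dots,M^d\}$ with $|T|\ge2$, $$\sum_{n=1}^\infty r^{n(D-k)}\,\mathbb E\, C_k^{\mathsf{var}}\Big(\bigcap_{j\in T}F_n^j\Big)<\infty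 ,$$ and the series $\sum_{n=1}^\infty r^{n(D-k)}\,\mathbb E\, V_k\big(\bigcap_{j\in T}F_n^j\big)$ (whose expectations all exist) converges absolutely. 3. Suppose $p>1/M$. Then for every $T\subset\{1,\dots,M^d\}$ with $|T|\ge2$, $$\sum_{n=1}^\infty r^{n(D-k)}\,\mathbb E\, C_k^{\mathsf{var}}\Big(\bigcap_{j\in T}C_n^j\Big)<\infty ,$$ and the series $\sum_{n=1}^\infty r^{n(D-k)}\,\mathbb E\, V_k\big(\bigcap_{j\in T}C_n^j\big)$ (whose expectations all exist) converges absolutely. -/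

import Mathlib

open MeasureTheory ProbabilityTheory
open scoped ENNReal

noncomputable section

/-! ### Curvature measures of compact convex and of polyconvex sets -/

/-- Euclidean space `ℝ^d`. -/
abbrev Space (d : ℕ) : Type := EuclideanSpace ℝ (Fin d)

/-- `κ_j`, the volume of the unit ball of `ℝ^j` (so `κ_0 = 1`). -/
def unitBallVolume (j : ℕ) : ℝ≥0∞ := volume (Metric.closedBall (0 : Space j) 1)

/-- The local parallel set: all points within distance `ε` of `K` that have a nearest point of `K`
in `B`. If `K` is closed and convex, the nearest point is unique. -/
def localParallelSet {d : ℕ} (K B : Set (Space d)) (ε : ℝ) : Set (Space d) :=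
  {x | ∃ y ∈ K ∩ B, dist x y = Metric.infDist x K ∧ dist x y ≤ ε}

/-- `C_0, …, C_d` are finite Borel measures that satisfy the local Steiner formula
`vol (localParallelSet K B ε) = ∑ k, ε^(d-k) κ_(d-k) C_k(B)` for all `ε > 0` and Borel sets `B`.
For compact convex `K` there is exactly one such family, the curvature measures of `K`. -/
def IsCurvatureFamily {d : ℕ} (K : Set (Space d)) (C : Fin (d + 1) → Measure (Space d)) : Prop :=
  (∀ k, IsFiniteMeasure (C k)) ∧
    ∀ ε : ℝ, 0 < ε → ∀ B : Set (Space d), MeasurableSet B →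
      volume (localParallelSet K B ε) =
        ∑ k : Fin (d + 1),
          ENNReal.ofReal (ε ^ (d - (k : ℕ))) * unitBallVolume (d - (k : ℕ)) * C k B

open Classical in
/-- The `k`-th curvature measure `C_k(K, ·)` of a compact convex set `K ⊆ ℝ^d`. -/
def convexCurvature {d : ℕ} (k : Fin (d + 1)) (K : Set (Space d)) : Measure (Space d) :=
  if h : ∃ C : Fin (d + 1) → Measure (Space d), IsCurvatureFamily K C then h.choose k else 0

instance convexCurvature_isFiniteMeasure {d : ℕ} (k : Fin (d + 1)) (K : Set (Space d)) :
    IsFiniteMeasure (convexCurvature k K) := by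
  unfold convexCurvature
  split_ifs with h
  · exact h.choose_spec.1 k
  · infer_instance

/-- `K` is the union of the compact convex sets `X_0, …, X_{m-1}`. -/
def IsConvexCover {d m : ℕ} (K : Set (Space d)) (X : Fin m → Set (Space d)) : Prop :=
  (∀ i, IsCompact (X i) ∧ Convex ℝ (X i)) ∧ K = ⋃ i, X i

/-- `∑_{∅ ≠ I} (-1)^(|I|+1) C_k(⋂_{i ∈ I} X_i, ·)`. -/
def inclusionExclusion {d m : ℕ} (k : Fin (d + 1)) (X : Fin m → Set (Space d)) :
    SignedMeasure (Space d) :=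
  ∑ I ∈ (Finset.univ : Finset (Finset (Fin m))) with I.Nonempty,
    ((-1 : ℝ) ^ (I.card + 1)) • (convexCurvature k (⋂ i ∈ I, X i)).toSignedMeasure

/-- `K` is polyconvex (a finite union of compact convex sets), and `ν` is the value at `K` of the
additive extension of the `k`-th curvature measure to polyconvex sets: `ν` is given by
inclusion-exclusion from every representation of `K` as a finite union of compact convex sets.
For every polyconvex set there is exactly one such `ν`. -/
def IsCurvatureMeasure {d : ℕ} (k : Fin (d + 1)) (K : Set (Space d))
    (ν : SignedMeasure (Space d)) : Prop :=
  (∃ (m : ℕ) (X : Fin m → Set (Space d)), IsConvexCover K X) ∧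
    ∀ (m : ℕ) (X : Fin m → Set (Space d)), IsConvexCover K X → ν = inclusionExclusion k X

open Classical in
/-- The `k`-th curvature measure `C_k(K, ·)` of a polyconvex set `K ⊆ ℝ^d`. -/
def curvatureMeasure {d : ℕ} (k : Fin (d + 1)) (K : Set (Space d)) : SignedMeasure (Space d) :=
  if h : ∃ ν : SignedMeasure (Space d), IsCurvatureMeasure k K ν then h.choose else 0

/-- `C_k^var(K)`, the total mass of the total variation measure of `C_k(K, ·)`. -/
def curvatureVar {d : ℕ} (k : Fin (d + 1)) (K : Set (Space d)) : ℝ≥0∞ :=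
  (curvatureMeasure k K).totalVariation Set.univ

/-- The `k`-th intrinsic volume `V_k(K) = C_k(K, ℝ^d)` of a polyconvex set. -/
def intrinsicVolume {d : ℕ} (k : Fin (d + 1)) (K : Set (Space d)) : ℝ :=
  curvatureMeasure k K Set.univ

/-! ### Fractal percolation -/

/-- Labels of the `M^d` subcubes of side length `1/M` of the unit cube: the label `i` stands for
the subcube `∏_a [i_a / M, (i_a + 1) / M]`. -/
abbrev Letter (d M : ℕ) : Type := Fin d → Fin M

/-- The similarity `φ_i` that maps the unit cube onto its subcube with label `i`. -/
def subcubeMap {d M : ℕ} (i : Letter d M) (x : Space d) : Space d :=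
  WithLp.toLp 2 fun a => (x a + ((i a : ℕ) : ℝ)) / (M : ℝ)

/-- The unit cube `J = [0,1]^d`. -/
def unitCube (d : ℕ) : Set (Space d) := {x | ∀ a, x a ∈ Set.Icc (0 : ℝ) 1}

/-- The cube `J_σ = φ_{σ_1} ∘ … ∘ φ_{σ_n} (J)` of the word `σ = σ_1 … σ_n`. -/
def cube {d M : ℕ} (σ : List (Letter d M)) : Set (Space d) :=
  σ.foldr (fun i K => subcubeMap i '' K) (unitCube d)

/-- The random choices that drive a fractal percolation with parameters `M` and `p`: for each
cube `J_σ` and each letter `i`, `Z σ i = true` means that the subcube `J_{σi}` is kept when `J_σ`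
is subdivided. All these choices are independent, and each is `true` with probability `p`. -/
structure IsFractalPercolation {Ω : Type*} [MeasurableSpace Ω] (μ : Measure Ω) {d M : ℕ} (p : ℝ)
    (Z : List (Letter d M) → Letter d M → Ω → Bool) : Prop where
  measurable : ∀ σ i, Measurable (Z σ i)
  indep : iIndepFun (fun w : List (Letter d M) × Letter d M => Z w.1 w.2) μ
  prob : ∀ σ i, μ {ω | Z σ i ω = true} = ENNReal.ofReal p

/-- `T_n`, the words of length `n` whose cube survives the first `n` steps. -/
def survivors {Ω : Type*} {d M : ℕ} (Z : List (Letter d M) → Letter d M → Ω → Bool) :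
    ℕ → Ω → Set (List (Letter d M))
  | 0, _ => {[]}
  | n + 1, ω => {τ | ∃ σ ∈ survivors Z n ω, ∃ i, Z σ i ω = true ∧ τ = σ ++ [i]}

/-- The `n`-th approximation `F_n`, the union of the cubes kept in the `n`-th step. -/
def approx {Ω : Type*} {d M : ℕ} (Z : List (Letter d M) → Letter d M → Ω → Bool)
    (n : ℕ) (ω : Ω) : Set (Space d) :=
  ⋃ σ ∈ survivors Z n ω, cube σ

/-- `F_n^j`, the union of the level-`n` cubes kept in the `n`-th step that are contained in the
first-level cube `J_j` (`n ≥ 1`). -/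
def approxPart {Ω : Type*} {d M : ℕ} (Z : List (Letter d M) → Letter d M → Ω → Bool)
    (n : ℕ) (j : Letter d M) (ω : Ω) : Set (Space d) :=
  ⋃ σ ∈ {σ | σ ∈ survivors Z n ω ∧ σ.head? = some j}, cube σ

/-- `C_n^j`, the union of the level-`n` cubes contained in `J_j` that do not survive the first
`n` steps (`n ≥ 1`). -/
def complPart {Ω : Type*} {d M : ℕ} (Z : List (Letter d M) → Letter d M → Ω → Bool)
    (n : ℕ) (j : Letter d M) (ω : Ω) : Set (Space d) :=
  ⋃ σ ∈ {σ | σ.length = n ∧ σ ∉ survivors Z n ω ∧ σ.head? = some j}, cube σ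

/-- `D = log (M^d p) / log M`. -/
def percolationDim (d M : ℕ) (p : ℝ) : ℝ := Real.log ((M : ℝ) ^ d * p) / Real.log M

end

/-! A crude count of cubes is enough. A convex piece inside a cube of side `s` has `k`-th curvature
mass at most a constant times `s ^ k` (`IsCurvatureFamily.univ_le`). In an inclusion-exclusion sum
over `m` such pieces, each meeting at most `B` of them, at most `m * 2 ^ B` terms survive
(`card_nonempty_iInter_le`). Level-`n` grid cubes have at most `3 ^ d` neighbours, so an
intersection of finitely many unions of them has curvature at most a constant times `r ^ (k n)`
times the number of cubes of one chosen union that meet all the others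
(`curvatureVar_iInter_iUnion_cube_le`).

It remains to count. For independent percolations, the kept cubes of one of them number `M ^ (d n) p
^ n` in expectation, which leaves a spare factor `r ^ n`, so `γ = 1 / M`. For parts in different
first-level cubes, only cubes along a common face matter, at most `2 M ^ ((d - 1) n)` of them
(`card_boundaryWords_le`). A fraction `p ^ n` of these is kept in expectation; for the complements
all are counted. After rescaling, the series are dominated by geometric ones with ratios `1 / M` and
`1 / (M p)`. -/

/-! ### Total variation of signed measures -/

/-- A signed measure that is dominated setwise by a finite sum of finite measures has total
variation at most the sum of their masses. -/
theorem totalVariation_univ_le_sum {α ι : Type*} [MeasurableSpace α] (S : Finset ι)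
    (μ : ι → Measure α) [∀ i, IsFiniteMeasure (μ i)] (ν : SignedMeasure α)
    (h : ∀ s, MeasurableSet s → |ν s| ≤ ∑ i ∈ S, (μ i).real s) :
    ν.totalVariation Set.univ ≤ ∑ i ∈ S, μ i Set.univ := by
  -- On a Hahn decomposition `P`, `Pᶜ` the total variation is `ν P - ν Pᶜ`, so the setwise bound is
  -- needed for these two sets only.
  obtain ⟨P, hP, h0, h1, hpos, hneg⟩ := ν.toJordanDecomposition_spec
  have hreal : (ν.totalVariation Set.univ).toReal ≤ ∑ i ∈ S, (μ i).real Set.univ := by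
    calc (ν.totalVariation Set.univ).toReal
        = ν P + -ν Pᶜ := by
          rw [SignedMeasure.totalVariation, hpos, hneg, ← measureReal_def, measureReal_add_apply,
            SignedMeasure.toMeasureOfZeroLE_real_apply _ _ _ MeasurableSet.univ,
            SignedMeasure.toMeasureOfLEZero_real_apply _ _ _ MeasurableSet.univ,
            Set.inter_univ, Set.inter_univ]
      _ ≤ (∑ i ∈ S, (μ i).real P) + ∑ i ∈ S, (μ i).real Pᶜ :=
          add_le_add ((le_abs_self _).trans (h P hP))
            ((neg_le_abs _).trans (h Pᶜ hP.compl))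
      _ = ∑ i ∈ S, (μ i).real Set.univ := by
          rw [← Finset.sum_add_distrib]
          exact Finset.sum_congr rfl fun i _ => measureReal_add_measureReal_compl hP
  have hfin : ν.totalVariation Set.univ ≠ ∞ := by
    rw [SignedMeasure.totalVariation]
    exact measure_ne_top _ _
  have hsum : (∑ i ∈ S, μ i Set.univ) ≠ ∞ := by
    simp
  refine (ENNReal.toReal_le_toReal hfin hsum).1 ?_
  rw [ENNReal.toReal_sum fun i _ => measure_ne_top _ _]
  exact hreal

theorem abs_apply_univ_le_totalVariation {α : Type*} [MeasurableSpace α] (ν : SignedMeasure α) :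
    |ν Set.univ| ≤ (ν.totalVariation Set.univ).toReal := by
  rw [SignedMeasure.apply_eq_posPart_real_sub_negPart_real ν MeasurableSet.univ,
    SignedMeasure.totalVariation, ← measureReal_def, measureReal_add_apply]
  refine (abs_sub _ _).trans ?_
  rw [abs_of_nonneg measureReal_nonneg, abs_of_nonneg measureReal_nonneg]

theorem abs_intrinsicVolume_le {d : ℕ} (k : Fin (d + 1)) (K : Set (Space d)) :
    |intrinsicVolume k K| ≤ (curvatureVar k K).toReal :=
  abs_apply_univ_le_totalVariation _

/-! ### Curvature measures of small convex sets -/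

/-- The axis-parallel cube of side length `s` with lowest corner `lo`. -/
def sideCube {d : ℕ} (lo : Fin d → ℝ) (s : ℝ) : Set (Space d) :=
  {x | ∀ a, x a ∈ Set.Icc (lo a) (lo a + s)}

theorem volume_sideCube {d : ℕ} (lo : Fin d → ℝ) {s : ℝ} (hs : 0 ≤ s) :
    volume (sideCube lo s) = ENNReal.ofReal (s ^ d) := by
  have h : sideCube lo s = WithLp.ofLp ⁻¹' Set.Icc lo (fun a => lo a + s) := by
    ext x
    simp only [sideCube, Set.mem_ofPred_eq, Set.mem_Icc, Set.mem_preimage, Pi.le_def, forall_and]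
  rw [h, (PiLp.volume_preserving_ofLp (Fin d)).measure_preimage
    measurableSet_Icc.nullMeasurableSet, Real.volume_Icc_pi]
  simp [ENNReal.ofReal_pow hs]

theorem localParallelSet_univ_subset {d : ℕ} {K : Set (Space d)} {lo : Fin d → ℝ} {s : ℝ}
    (hK : K ⊆ sideCube lo s) :
    localParallelSet K Set.univ s ⊆ sideCube (fun a => lo a - s) (3 * s) := by
  rintro x ⟨y, ⟨hyK, -⟩, -, hxy⟩ a
  have hy := hK hyK a
  have h1 : |x a - y a| ≤ s := by
    have h2 := PiLp.norm_apply_le (x - y) a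
    rw [← dist_eq_norm] at h2
    exact (by simpa using h2 : |x a - y a| ≤ dist x y).trans hxy
  rw [abs_le] at h1
  rw [Set.mem_Icc] at hy ⊢
  constructor <;> linarith

/-- A bound for the total mass of the `k`-th curvature measure of a convex subset of a unit cube. -/
noncomputable def curvatureBound {d : ℕ} (k : Fin (d + 1)) : ℝ≥0∞ :=
  3 ^ d / unitBallVolume (d - (k : ℕ))

theorem unitBallVolume_ne_zero (j : ℕ) : unitBallVolume j ≠ 0 :=
  (Metric.measure_closedBall_pos volume _ one_pos).ne'

theorem unitBallVolume_ne_top (j : ℕ) : unitBallVolume j ≠ ∞ :=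
  measure_closedBall_lt_top.ne

theorem curvatureBound_ne_top {d : ℕ} (k : Fin (d + 1)) : curvatureBound k ≠ ∞ :=
  ENNReal.div_ne_top (by finiteness) (unitBallVolume_ne_zero _)

theorem IsCurvatureFamily.term_le {d : ℕ} {K : Set (Space d)}
    {C : Fin (d + 1) → Measure (Space d)} (hC : IsCurvatureFamily K C) {s : ℝ} (hs : 0 < s)
    (k : Fin (d + 1)) :
    ENNReal.ofReal (s ^ (d - (k : ℕ))) * unitBallVolume (d - (k : ℕ)) * C k Set.univ ≤
      volume (localParallelSet K Set.univ s) := by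
  rw [hC.2 s hs Set.univ MeasurableSet.univ]
  exact Finset.single_le_sum (f := fun k : Fin (d + 1) =>
    ENNReal.ofReal (s ^ (d - (k : ℕ))) * unitBallVolume (d - (k : ℕ)) * C k Set.univ)
    (fun _ _ => zero_le) (Finset.mem_univ k)

/-- All Steiner terms are nonnegative, so the `k`-th alone is bounded by the volume of the parallel
set. With the radius equal to the side `s`, that set fits in a cube of side `3 * s`; dividing `(3 *
s) ^ d` by `s ^ (d - k)` leaves the order `s ^ k`. -/
theorem IsCurvatureFamily.univ_le {d : ℕ} {K : Set (Space d)}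
    {C : Fin (d + 1) → Measure (Space d)} (hC : IsCurvatureFamily K C) {s : ℝ} (hs : 0 < s)
    {lo : Fin d → ℝ} (hK : K ⊆ sideCube lo s) (k : Fin (d + 1)) :
    C k Set.univ ≤ curvatureBound k * ENNReal.ofReal (s ^ (k : ℕ)) := by
  have h1 := (hC.term_le hs k).trans (measure_mono (localParallelSet_univ_subset hK))
  have hkd : s ^ d = s ^ (d - (k : ℕ)) * s ^ (k : ℕ) := by
    rw [← pow_add, Nat.sub_add_cancel (Nat.lt_succ_iff.1 k.2)]
  rw [volume_sideCube _ (by positivity), mul_pow, hkd, ENNReal.ofReal_mul (by positivity),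
    ENNReal.ofReal_mul (by positivity)] at h1
  have h3 : ENNReal.ofReal ((3 : ℝ) ^ d) = 3 ^ d := by
    rw [ENNReal.ofReal_pow (by norm_num)]; simp
  rw [h3] at h1
  have hb0 : ENNReal.ofReal (s ^ (d - (k : ℕ))) ≠ 0 := by
    simpa using pow_pos hs _
  rw [show (3 : ℝ≥0∞) ^ d * (ENNReal.ofReal (s ^ (d - (k : ℕ))) * ENNReal.ofReal (s ^ (k : ℕ)))
    = ENNReal.ofReal (s ^ (d - (k : ℕ))) * (3 ^ d * ENNReal.ofReal (s ^ (k : ℕ))) by ring,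
    mul_assoc, ENNReal.mul_le_mul_iff_right hb0 ENNReal.ofReal_ne_top] at h1
  rw [curvatureBound, ENNReal.mul_comm_div, ← mul_div_assoc,
    ENNReal.le_div_iff_mul_le (Or.inl (unitBallVolume_ne_zero _))
      (Or.inl (unitBallVolume_ne_top _)), mul_comm]
  exact h1

/-- This removes from inclusion-exclusion every subfamily without a common point. -/
theorem IsCurvatureFamily.eq_zero_of_empty {d : ℕ} {C : Fin (d + 1) → Measure (Space d)}
    (hC : IsCurvatureFamily ∅ C) (k : Fin (d + 1)) : C k Set.univ = 0 := by
  have h1 := hC.term_le one_pos k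
  have h2 : localParallelSet (∅ : Set (Space d)) Set.univ 1 = ∅ := by
    ext x; simp [localParallelSet]
  rw [h2, measure_empty] at h1
  simpa [unitBallVolume_ne_zero] using h1

theorem convexCurvature_univ_le {d : ℕ} (k : Fin (d + 1)) {K : Set (Space d)} {s : ℝ}
    (hs : 0 < s) {lo : Fin d → ℝ} (hK : K ⊆ sideCube lo s) :
    convexCurvature k K Set.univ ≤ curvatureBound k * ENNReal.ofReal (s ^ (k : ℕ)) := by
  unfold convexCurvature
  split_ifs with h
  · exact h.choose_spec.univ_le hs hK k
  -- The default value `0` satisfies the bound too, so existence of a Steiner family is not needed.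
  · simp

theorem convexCurvature_empty_univ {d : ℕ} (k : Fin (d + 1)) :
    convexCurvature k (∅ : Set (Space d)) Set.univ = 0 := by
  unfold convexCurvature
  split_ifs with h
  · exact h.choose_spec.eq_zero_of_empty k
  · simp

/-! ### Total variation of curvature measures of unions of small convex sets -/

/-- If every `X i` meets at most `B` of the sets `X j`, then at most `m * 2 ^ B` nonempty
subfamilies of `X` have a common point. -/
theorem card_nonempty_iInter_le {α : Type*} {m : ℕ} (X : Fin m → Set α) (B : ℕ)
    (hB : ∀ i, {j | (X i ∩ X j).Nonempty}.ncard ≤ B) :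
    {I : Finset (Fin m) | I.Nonempty ∧ (⋂ i ∈ I, X i).Nonempty}.ncard ≤ m * 2 ^ B := by
  classical
  let N : Fin m → Finset (Fin m) := fun i => {j | (X i ∩ X j).Nonempty}
  have hN : ∀ i, (N i).card ≤ B := fun i => by
    refine le_trans (le_of_eq ?_) (hB i)
    rw [← Set.ncard_coe_finset]
    simp [N]
  -- A subfamily with a common point lies in the neighbourhood `N i` of each of its members `i`: `m`
  -- choices of `i`, then at most `2 ^ B` subsets.
  have hsub : {I : Finset (Fin m) | I.Nonempty ∧ (⋂ i ∈ I, X i).Nonempty} ⊆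
      ((Finset.univ.biUnion fun i => (N i).powerset : Finset (Finset (Fin m))) :
        Set (Finset (Fin m))) := by
    rintro I ⟨⟨i, hi⟩, x, hx⟩
    simp only [Set.mem_iInter] at hx
    simp only [Finset.coe_biUnion, Set.mem_iUnion, Finset.mem_coe, Finset.mem_powerset]
    exact ⟨i, Finset.mem_univ i, fun j hj =>
      Finset.mem_filter.2 ⟨Finset.mem_univ j, x, hx i hi, hx j hj⟩⟩
  refine (Set.ncard_le_ncard hsub (Finset.finite_toSet _)).trans ?_
  rw [Set.ncard_coe_finset]
  refine (Finset.card_biUnion_le_card_mul _ _ (2 ^ B) fun i _ => ?_).trans (by simp)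
  rw [Finset.card_powerset]
  exact Nat.pow_le_pow_right two_pos (hN i)

/-- The signs disappear in absolute value, and each nonvanishing term is the curvature of a set
inside some `X i`. -/
theorem totalVariation_inclusionExclusion_le {d m : ℕ} (k : Fin (d + 1))
    (X : Fin m → Set (Space d)) {s : ℝ} (hs : 0 < s)
    (hX : ∀ i, ∃ lo : Fin d → ℝ, X i ⊆ sideCube lo s) (B : ℕ)
    (hB : ∀ i, {j | (X i ∩ X j).Nonempty}.ncard ≤ B) :
    (inclusionExclusion k X).totalVariation Set.univ ≤
      ((m * 2 ^ B : ℕ) : ℝ≥0∞) * (curvatureBound k * ENNReal.ofReal (s ^ (k : ℕ))) := by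
  classical
  refine (totalVariation_univ_le_sum
    ((Finset.univ : Finset (Finset (Fin m))).filter Finset.Nonempty)
    (fun I => convexCurvature k (⋂ i ∈ I, X i)) _ fun t ht => ?_).trans ?_
  · rw [inclusionExclusion]
    rw [← FunLike.coeAddMonoidHom_apply, map_sum, Finset.sum_apply]
    refine (Finset.abs_sum_le_sum_abs _ _).trans (Finset.sum_le_sum fun I _ => ?_)
    rw [FunLike.coeAddMonoidHom_apply, _root_.smul_apply,
      Measure.toSignedMeasure_apply_measurable ht, smul_eq_mul, abs_mul, abs_pow, abs_neg,
      abs_one, one_pow, one_mul, abs_of_nonneg measureReal_nonneg]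
  · have hterm : ∀ I ∈ (Finset.univ : Finset (Finset (Fin m))).filter Finset.Nonempty,
        convexCurvature k (⋂ i ∈ I, X i) Set.univ ≤
          if (⋂ i ∈ I, X i).Nonempty then curvatureBound k * ENNReal.ofReal (s ^ (k : ℕ))
          else 0 := by
      intro I hI
      obtain ⟨i, hi⟩ := (Finset.mem_filter.1 hI).2
      split_ifs with h
      · obtain ⟨lo, hlo⟩ := hX i
        exact convexCurvature_univ_le k hs ((Set.biInter_subset_of_mem hi).trans hlo)
      · rw [Set.not_nonempty_iff_eq_empty.1 h, convexCurvature_empty_univ]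
    refine (Finset.sum_le_sum hterm).trans ?_
    rw [← Finset.sum_filter, Finset.sum_const, nsmul_eq_mul]
    gcongr
    refine le_trans (le_of_eq ?_) (card_nonempty_iInter_le X B hB)
    rw [← Set.ncard_coe_finset]
    simp

theorem curvatureVar_iUnion_le {d : ℕ} {ι : Type*} [Fintype ι] (k : Fin (d + 1))
    (X : ι → Set (Space d)) (hc : ∀ i, IsCompact (X i) ∧ Convex ℝ (X i)) {s : ℝ} (hs : 0 < s)
    (hX : ∀ i, ∃ lo : Fin d → ℝ, X i ⊆ sideCube lo s) (B : ℕ)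
    (hB : ∀ i, {j | (X i ∩ X j).Nonempty}.ncard ≤ B) :
    curvatureVar k (⋃ i, X i) ≤
      ((Fintype.card ι * 2 ^ B : ℕ) : ℝ≥0∞) *
        (curvatureBound k * ENNReal.ofReal (s ^ (k : ℕ))) := by
  let e := (Fintype.equivFin ι).symm
  have hcover : IsConvexCover (⋃ i, X i) (X ∘ e) :=
    ⟨fun i => hc _, (e.surjective.iUnion_comp X).symm⟩
  unfold curvatureVar curvatureMeasure
  split_ifs with h
  -- Every convex cover computes the curvature measure, so this cover by small sets may be used; in
  -- the other case the measure is `0` by default.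
  · rw [h.choose_spec.2 _ _ hcover]
    refine totalVariation_inclusionExclusion_le k (X ∘ e) hs (fun i => hX _) B fun i => ?_
    refine le_trans ?_ (hB (e i))
    refine Set.ncard_le_ncard_of_injOn e (fun j hj => hj) e.injective.injOn (Set.toFinite _)
  · rw [SignedMeasure.totalVariation_zero]
    simp

/-! ### Grid cubes -/

/-- The grid position of the cube `J_σ`: its lowest corner is `M^(-|σ|) • gridPos σ`. -/
def gridPos {d M : ℕ} : List (Letter d M) → Fin d → ℕ
  | [], _ => 0
  | i :: σ, a => i a * M ^ σ.length + gridPos σ a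

theorem gridPos_lt {d M : ℕ} (σ : List (Letter d M)) (a : Fin d) :
    gridPos σ a < M ^ σ.length := by
  induction σ with
  | nil => simp [gridPos]
  | cons i σ ih =>
    have h1 : ((i a : ℕ) + 1) * M ^ σ.length ≤ M * M ^ σ.length :=
      Nat.mul_le_mul_right _ (i a).2
    simp only [gridPos, List.length_cons, pow_succ']
    linarith

/-- In each coordinate `gridPos` reads the word as a base-`M` numeral of fixed length. Division by
`M ^ σ.length` recovers the leading digit because the rest is smaller, by `gridPos_lt`. -/
theorem gridPos_inj {d M : ℕ} {σ τ : List (Letter d M)} (hl : σ.length = τ.length)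
    (h : gridPos σ = gridPos τ) : σ = τ := by
  induction σ generalizing τ with
  | nil => exact (List.length_eq_zero_iff.1 hl.symm).symm
  | cons i σ ih =>
    cases τ with
    | nil => simp at hl
    | cons j τ =>
      have hl' : σ.length = τ.length := by simpa using hl
      have key : ∀ a, (i a : ℕ) = j a ∧ gridPos σ a = gridPos τ a := fun a => by
        have h1 := congrFun h a
        simp only [gridPos, ← hl'] at h1
        have h2 := gridPos_lt σ a
        have h3 := gridPos_lt τ a
        rw [← hl'] at h3
        have h4 : (i a : ℕ) = j a := by
          have := congrArg (· / M ^ σ.length) h1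
          simpa [Nat.add_div_of_dvd_right, Nat.div_eq_of_lt h2, Nat.div_eq_of_lt h3,
            (Nat.zero_le _).trans_lt h2] using this
        rw [h4] at h1
        exact ⟨h4, Nat.add_left_cancel h1⟩
      rw [ih hl' (funext fun a => (key a).2), funext fun a => Fin.ext (key a).1]

theorem cube_eq_sideCube {d M : ℕ} (hM : 0 < M) (σ : List (Letter d M)) :
    cube σ = sideCube (fun a => gridPos σ a * (1 / (M : ℝ)) ^ σ.length)
      ((1 / (M : ℝ)) ^ σ.length) := by
  have hM' : (M : ℝ) ≠ 0 := by positivity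
  induction σ with
  | nil => simp [cube, sideCube, unitCube, gridPos]
  | cons i σ ih =>
    have h1 : cube (i :: σ) = subcubeMap i '' cube σ := rfl
    rw [h1, ih]
    ext x
    simp only [sideCube, Set.mem_image, Set.mem_ofPred_eq, Set.mem_Icc, gridPos,
      List.length_cons]
    have e1 : ∀ a, (((i a * M ^ σ.length + gridPos σ a : ℕ) : ℝ)) * (1 / (M : ℝ)) ^ (σ.length + 1)
        = (gridPos σ a * (1 / (M : ℝ)) ^ σ.length + (i a : ℕ)) / M := fun a => by
      rw [pow_succ]; push_cast; simp only [one_div, inv_pow]; field_simp; ring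
    have e2 : (1 / (M : ℝ)) ^ (σ.length + 1) = (1 / (M : ℝ)) ^ σ.length / M := by
      rw [pow_succ]; field_simp
    have hMp : (0 : ℝ) < M := by positivity
    constructor
    · rintro ⟨y, hy, rfl⟩ a
      rw [e1, e2, ← add_div]
      simp only [subcubeMap]
      constructor
      · gcongr; exact (hy a).1
      · rw [add_right_comm]; gcongr; exact (hy a).2
    · intro hx
      refine ⟨WithLp.toLp 2 fun a => x a * M - (i a : ℕ), fun a => ?_, ?_⟩
      · have := hx a
        rw [e1, e2, ← add_div, div_le_iff₀ hMp, le_div_iff₀ hMp] at this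
        constructor
        · simp only; linarith
        · simp only; linarith
      · ext a
        simp only [subcubeMap]
        field_simp
        ring

theorem isCompact_sideCube {d : ℕ} (lo : Fin d → ℝ) (s : ℝ) : IsCompact (sideCube lo s) := by
  have h : sideCube lo s = WithLp.toLp 2 '' Set.Icc lo (fun a => lo a + s) := by
    ext x
    simp only [sideCube, Set.mem_ofPred_eq, Set.mem_Icc, Set.mem_image, Pi.le_def,
      ← forall_and]
    exact ⟨fun h => ⟨x.ofLp, h, rfl⟩, by rintro ⟨y, h, rfl⟩; exact h⟩
  rw [h]
  exact isCompact_Icc.image (PiLp.continuous_toLp 2 _)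

theorem convex_sideCube {d : ℕ} (lo : Fin d → ℝ) (s : ℝ) : Convex ℝ (sideCube lo s) := by
  intro x hx y hy α β hα hβ hαβ a
  exact convex_Icc _ _ (hx a) (hy a) hα hβ hαβ

/-- Positions of intersecting cubes of the same level differ by at most one. -/
theorem gridPos_le_of_cube_inter {d M : ℕ} (hM : 0 < M) {σ τ : List (Letter d M)}
    (hl : σ.length = τ.length) (h : (cube σ ∩ cube τ).Nonempty) (a : Fin d) :
    gridPos σ a ≤ gridPos τ a + 1 := by
  obtain ⟨x, hx, hy⟩ := h
  rw [cube_eq_sideCube hM] at hx hy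
  have h1 := (hx a).1
  have h2 := (hy a).2
  rw [← hl] at h2
  have hpos : (0 : ℝ) < (1 / (M : ℝ)) ^ σ.length := by positivity
  have h3 : (gridPos σ a : ℝ) * (1 / (M : ℝ)) ^ σ.length ≤
      (gridPos τ a + 1) * (1 / (M : ℝ)) ^ σ.length := by linarith
  exact_mod_cast le_of_mul_le_mul_right h3 hpos

/-! ### Counting words -/

/-- The words of length `n`. -/
noncomputable def words (d M n : ℕ) : Finset (List (Letter d M)) :=
  (List.finite_length_eq (Letter d M) n).toFinset

@[simp]
theorem mem_words {d M n : ℕ} {σ : List (Letter d M)} : σ ∈ words d M n ↔ σ.length = n := by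
  simp [words]

/-- By injectivity of `gridPos`, counting words becomes counting lattice points in a box. -/
theorem card_words_le_of_gridPos {d M n : ℕ} (S : Finset (List (Letter d M)))
    (hS : S ⊆ words d M n) (P : Fin d → Finset ℕ) (h : ∀ σ ∈ S, ∀ a, gridPos σ a ∈ P a) :
    S.card ≤ ∏ a, (P a).card := by
  rw [← Fintype.card_piFinset]
  refine Finset.card_le_card_of_injOn gridPos (fun σ hσ => ?_) fun σ hσ τ hτ hστ => ?_
  · exact Fintype.mem_piFinset.2 (h σ hσ)
  · exact gridPos_inj ((mem_words.1 (hS hσ)).trans (mem_words.1 (hS hτ)).symm) hστ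

theorem card_words_le (d M n : ℕ) : (words d M n).card ≤ (M ^ n) ^ d := by
  refine (card_words_le_of_gridPos _ subset_rfl (fun _ => Finset.range (M ^ n))
    fun σ hσ a => ?_).trans (by simp)
  rw [Finset.mem_range, ← mem_words.1 hσ]
  exact gridPos_lt σ a

open Classical in
/-- The words of the same length as `σ` whose cube meets `J_σ`. -/
noncomputable def neighbours {d M : ℕ} (σ : List (Letter d M)) : Finset (List (Letter d M)) :=
  {τ ∈ words d M σ.length | (cube σ ∩ cube τ).Nonempty}

theorem mem_neighbours {d M : ℕ} {σ τ : List (Letter d M)} :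
    τ ∈ neighbours σ ↔ τ.length = σ.length ∧ (cube σ ∩ cube τ).Nonempty := by
  classical
  simp [neighbours]

theorem card_neighbours_le {d M : ℕ} (hM : 0 < M) (σ : List (Letter d M)) :
    (neighbours σ).card ≤ 3 ^ d := by
  refine (card_words_le_of_gridPos (n := σ.length) _ (fun τ hτ => ?_)
    (fun a => Finset.Icc (gridPos σ a - 1) (gridPos σ a + 1)) fun τ hτ a => ?_).trans ?_
  · exact mem_words.2 (mem_neighbours.1 hτ).1
  · obtain ⟨hl, h⟩ := mem_neighbours.1 hτ
    have h1 := gridPos_le_of_cube_inter hM hl.symm h a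
    have h2 := gridPos_le_of_cube_inter hM hl (Set.inter_comm _ _ ▸ h) a
    rw [Finset.mem_Icc]
    omega
  · refine (Finset.prod_le_prod' (g := fun _ => 3) fun a _ => ?_).trans (by simp)
    rw [Nat.card_Icc]
    omega

open Classical in
/-- The words of length `n` with first letter `i` whose cube meets the cube of a word of length `n`
with first letter `j`. -/
noncomputable def boundaryWords {d M : ℕ} (n : ℕ) (i j : Letter d M) :
    Finset (List (Letter d M)) :=
  {σ ∈ words d M n | σ.head? = some i ∧ ∃ τ ∈ neighbours σ, τ.head? = some j}

theorem boundaryWords_subset {d M : ℕ} (n : ℕ) (i j : Letter d M) :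
    boundaryWords n i j ⊆ words d M n := by
  classical
  exact Finset.filter_subset _ _

theorem gridPos_bounds_of_head {d M : ℕ} {σ : List (Letter d M)} {i : Letter d M} {n : ℕ}
    (hl : σ.length = n + 1) (h : σ.head? = some i) (a : Fin d) :
    i a * M ^ n ≤ gridPos σ a ∧ gridPos σ a + 1 ≤ (i a + 1) * M ^ n := by
  cases σ with
  | nil => simp at h
  | cons i' σ =>
    obtain rfl : i' = i := by simpa using h
    have hl' : σ.length = n := by simpa using hl
    have h2 := gridPos_lt σ a
    rw [hl'] at h2
    simp only [gridPos, hl']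
    constructor
    · omega
    · rw [add_mul, one_mul]; omega

/-- In a coordinate `b` where `i` and `j` differ, the two words have positions in disjoint blocks of
length `M ^ n`, yet these differ by at most one. So the position of `σ` is the first or last of its
block; the other `d - 1` coordinates are free. -/
theorem card_boundaryWords_le {d M : ℕ} (hM : 0 < M) (n : ℕ) {i j : Letter d M} (hij : i ≠ j) :
    (boundaryWords (n + 1) i j).card ≤ 2 * (M ^ (n + 1)) ^ (d - 1) := by
  classical
  obtain ⟨b, hb⟩ : ∃ b, i b ≠ j b := by
    by_contra! h
    exact hij (funext h)
  let P : Fin d → Finset ℕ := Function.update (fun _ => Finset.range (M ^ (n + 1))) b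
    {i b * M ^ n, (i b + 1) * M ^ n - 1}
  refine (card_words_le_of_gridPos (n := n + 1) _ (boundaryWords_subset _ _ _) P
    fun σ hσ a => ?_).trans ?_
  · obtain ⟨hl, hi, τ, hτ, hj⟩ := Finset.mem_filter.1 hσ
    rw [mem_words] at hl
    by_cases hab : a = b
    · subst hab
      obtain ⟨hl', hστ⟩ := mem_neighbours.1 hτ
      have h1 := gridPos_le_of_cube_inter hM hl'.symm hστ a
      have h2 := gridPos_le_of_cube_inter hM hl' (Set.inter_comm _ _ ▸ hστ) a
      obtain ⟨h3, h4⟩ := gridPos_bounds_of_head hl hi a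
      obtain ⟨h5, h6⟩ := gridPos_bounds_of_head (hl'.trans hl) hj a
      simp only [P, Function.update_self, Finset.mem_insert, Finset.mem_singleton]
      rcases lt_or_gt_of_ne (fun h => hb (Fin.ext h) : (i a : ℕ) ≠ j a) with h | h
      · right
        have : (i a + 1) * M ^ n ≤ j a * M ^ n := Nat.mul_le_mul_right _ h
        omega
      · left
        have : (j a + 1) * M ^ n ≤ i a * M ^ n := Nat.mul_le_mul_right _ h
        omega
    · simp only [P, Function.update_of_ne hab, Finset.mem_range]
      rw [← hl]
      exact gridPos_lt σ a
  · rw [← Finset.mul_prod_erase _ _ (Finset.mem_univ b)]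
    refine Nat.mul_le_mul ?_ (le_of_eq ?_)
    · simp only [P, Function.update_self]
      exact Finset.card_le_two
    · rw [Finset.prod_congr rfl (g := fun _ => M ^ (n + 1)) fun a ha => by
        simp [P, Function.update_of_ne (Finset.ne_of_mem_erase ha)]]
      simp

/-! ### Intersections of unions of grid cubes -/

/-- The constant in the bound for the curvature of an intersection of `N` unions of grid cubes. -/
noncomputable def gridBound {d : ℕ} (k : Fin (d + 1)) (N : ℕ) : ℝ≥0∞ :=
  (((3 ^ d) ^ N * 2 ^ ((3 ^ d) ^ N) : ℕ) : ℝ≥0∞) * curvatureBound k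

theorem gridBound_ne_top {d : ℕ} (k : Fin (d + 1)) (N : ℕ) : gridBound k N ≠ ∞ :=
  ENNReal.mul_ne_top (ENNReal.natCast_ne_top _) (curvatureBound_ne_top k)

/-- The intersection of the unions of the level-`n` cubes with labels in `S a` has curvature at
most a constant times `M^(-kn)` times the number of labels in `S a₀` whose cubes meet all the
unions. -/
theorem curvatureVar_iInter_iUnion_cube_le {d M : ℕ} (hM : 0 < M) (k : Fin (d + 1)) {A : Type*}
    [Fintype A] (n : ℕ) (S : A → Finset (List (Letter d M))) (hS : ∀ a, S a ⊆ words d M n)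
    (a₀ : A) (G : Finset (List (Letter d M)))
    (hG : ∀ σ ∈ S a₀, (∀ a, ∃ τ ∈ S a, τ ∈ neighbours σ) → σ ∈ G) :
    curvatureVar k (⋂ a, ⋃ σ ∈ S a, cube σ) ≤
      gridBound k (Fintype.card A) * ENNReal.ofReal (((1 / (M : ℝ)) ^ n) ^ (k : ℕ)) * G.card := by
  classical
  -- Distributing the intersection over the unions gives one convex piece for each tuple of cubes
  -- with a common point.
  let Q : Finset (A → List (Letter d M)) :=
    {f ∈ Fintype.piFinset S | (⋂ a, cube (f a)).Nonempty}
  have hQ : ∀ f ∈ Q, (∀ a, f a ∈ S a) ∧ (⋂ a, cube (f a)).Nonempty := fun f hf => by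
    simpa [Q] using hf
  have hlen : ∀ f ∈ Q, ∀ a, (f a).length = n := fun f hf a => mem_words.1 (hS a ((hQ f hf).1 a))
  have hunion : (⋂ a, ⋃ σ ∈ S a, cube σ) = ⋃ f : Q, ⋂ a, cube (f.1 a) := by
    ext x
    simp only [Set.mem_iInter, Set.mem_iUnion, exists_prop]
    constructor
    · intro hx
      choose f hf hxf using hx
      exact ⟨⟨f, by simpa [Q] using ⟨hf, x, hxf⟩⟩, hxf⟩
    · rintro ⟨f, hx⟩ a
      exact ⟨f.1 a, (hQ f.1 f.2).1 a, hx a⟩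
  have hcompact : ∀ σ : List (Letter d M), IsCompact (cube σ) := fun σ => by
    rw [cube_eq_sideCube hM]; exact isCompact_sideCube _ _
  have hconvex : ∀ σ : List (Letter d M), Convex ℝ (cube σ) := fun σ => by
    rw [cube_eq_sideCube hM]; exact convex_sideCube _ _
  have hcardPi : ∀ f : A → List (Letter d M),
      (Fintype.piFinset fun a => neighbours (f a)).card ≤ (3 ^ d) ^ Fintype.card A := fun f => by
    rw [Fintype.card_piFinset]
    exact (Finset.prod_le_prod' fun a _ => card_neighbours_le hM (f a)).trans (by simp)
  -- All entries of such a tuple are neighbours of its entry at `a₀`, which lies in `G`.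
  have hQcard : Q.card ≤ G.card * (3 ^ d) ^ Fintype.card A := by
    refine (Finset.card_le_card (t := G.biUnion fun σ =>
      Fintype.piFinset fun _ : A => neighbours σ) fun f hf => ?_).trans
      (Finset.card_biUnion_le_card_mul _ _ _ fun σ _ => hcardPi fun _ => σ)
    obtain ⟨h1, x, hx⟩ := hQ f hf
    rw [Set.mem_iInter] at hx
    have hnb : ∀ a, f a ∈ neighbours (f a₀) := fun a =>
      mem_neighbours.2 ⟨(hlen f hf a).trans (hlen f hf a₀).symm, x, hx a₀, hx a⟩
    exact Finset.mem_biUnion.2 ⟨f a₀, hG _ (h1 a₀) fun a => ⟨f a, h1 a, hnb a⟩,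
      Fintype.mem_piFinset.2 hnb⟩
  rw [hunion]
  refine (curvatureVar_iUnion_le k (fun f : Q => ⋂ a, cube (f.1 a)) (fun f => ⟨?_, ?_⟩)
    (s := (1 / (M : ℝ)) ^ n) (by positivity) (fun f => ?_) ((3 ^ d) ^ Fintype.card A)
    fun f => ?_).trans ?_
  · exact (hcompact (f.1 a₀)).of_isClosed_subset (isClosed_iInter fun a => (hcompact _).isClosed)
      (Set.iInter_subset _ a₀)
  · exact convex_iInter fun a => hconvex _
  · have h := (cube_eq_sideCube hM (f.1 a₀)).subset
    rw [hlen f.1 f.2 a₀] at h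
    exact ⟨_, (Set.iInter_subset _ a₀).trans h⟩
  -- If two pieces meet, their tuples are entrywise neighbours.
  · refine le_trans ?_ (hcardPi f.1)
    rw [← Set.ncard_coe_finset]
    refine Set.ncard_le_ncard_of_injOn Subtype.val (fun g hg => ?_) Subtype.val_injective.injOn
      (Finset.finite_toSet _)
    obtain ⟨x, hxf, hxg⟩ := hg
    rw [Set.mem_iInter] at hxf hxg
    exact Finset.mem_coe.2 (Fintype.mem_piFinset.2 fun a =>
      mem_neighbours.2 ⟨(hlen g.1 g.2 a).trans (hlen f.1 f.2 a).symm, x, hxf a, hxg a⟩)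
  · rw [Fintype.card_coe]
    calc ((Q.card * 2 ^ (3 ^ d) ^ Fintype.card A : ℕ) : ℝ≥0∞) *
          (curvatureBound k * ENNReal.ofReal (((1 / (M : ℝ)) ^ n) ^ (k : ℕ)))
        ≤ ((G.card * (3 ^ d) ^ Fintype.card A * 2 ^ (3 ^ d) ^ Fintype.card A : ℕ) : ℝ≥0∞) *
          (curvatureBound k * ENNReal.ofReal (((1 / (M : ℝ)) ^ n) ^ (k : ℕ))) := by gcongr
      _ = _ := by
          rw [gridBound]
          push_cast
          ring

/-! ### Survival probabilities -/

theorem mem_survivors_iff {Ω : Type*} {d M : ℕ} {Z : List (Letter d M) → Letter d M → Ω → Bool}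
    {n : ℕ} {ω : Ω} {σ : List (Letter d M)} :
    σ ∈ survivors Z n ω ↔
      σ.length = n ∧ ∀ m : Fin σ.length, Z (σ.take m) σ[m] ω = true := by
  induction n generalizing σ with
  | zero =>
    simp only [survivors, Set.mem_singleton_iff, List.length_eq_zero_iff]
    exact ⟨fun h => ⟨h, by subst h; exact fun m => m.elim0⟩, fun h => h.1⟩
  | succ n ih =>
    simp only [survivors, Set.mem_ofPred_eq, ih]
    constructor
    · rintro ⟨τ, ⟨hl, hτ⟩, i, hi, rfl⟩
      refine ⟨by simp [hl], fun ⟨m, hm⟩ => ?_⟩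
      simp only [List.length_append, List.length_singleton] at hm
      rcases Nat.lt_succ_iff_lt_or_eq.1 hm with h | rfl
      · simpa [List.take_append_of_le_length h.le, List.getElem_append_left h] using hτ ⟨m, h⟩
      · simpa using hi
    · rintro ⟨hl, h⟩
      obtain rfl | ⟨τ, i, rfl⟩ := List.eq_nil_or_concat' σ
      · simp at hl
      · have hl' : τ.length = n := by simpa using hl
        refine ⟨τ, ⟨hl', fun ⟨m, hm⟩ => ?_⟩, i, ?_, rfl⟩
        · have := h ⟨m, by simp; omega⟩
          simpa [List.take_append_of_le_length hm.le, List.getElem_append_left hm] using this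
        · simpa using h ⟨τ.length, by simp⟩

section Percolation

variable {Ω : Type*} [MeasurableSpace Ω] {μ : Measure Ω} {d M : ℕ} {p : ℝ}
  {Z : List (Letter d M) → Letter d M → Ω → Bool}

theorem IsFractalPercolation.measurableSet_survives (hZ : IsFractalPercolation μ p Z) (n : ℕ)
    (σ : List (Letter d M)) : MeasurableSet {ω | σ ∈ survivors Z n ω} := by
  have hset : {ω | σ ∈ survivors Z n ω} =
      {_ω | σ.length = n} ∩ ⋂ m : Fin σ.length, Z (σ.take m) σ[m] ⁻¹' {true} := by
    ext ω
    simp [mem_survivors_iff]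
  rw [hset]
  exact (MeasurableSet.const _).inter
    (MeasurableSet.iInter fun m => hZ.measurable _ _ (MeasurableSet.singleton true))

theorem IsFractalPercolation.measure_survives (hZ : IsFractalPercolation μ p Z)
    (σ : List (Letter d M)) :
    μ {ω | σ ∈ survivors Z σ.length ω} = ENNReal.ofReal p ^ σ.length := by
  classical
  let f : Fin σ.length → List (Letter d M) × Letter d M := fun m => (σ.take m, σ[m])
  -- The choices along the path to `σ` sit at prefixes of different lengths, hence are distinct and
  -- independent.
  have hf : Function.Injective f := fun m m' h => by
    have := congrArg (fun w => w.1.length) h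
    simp only [f, List.length_take] at this
    ext
    omega
  have hset : {ω | σ ∈ survivors Z σ.length ω} =
      ⋂ w ∈ Finset.univ.image f, (fun ω => Z w.1 w.2 ω) ⁻¹' {true} := by
    ext ω
    simp [mem_survivors_iff, f]
  rw [hset, hZ.indep.measure_inter_preimage_eq_mul _ fun _ _ => MeasurableSet.singleton true,
    Finset.prod_image hf.injOn]
  have : ∀ m, μ ((fun ω => Z (f m).1 (f m).2 ω) ⁻¹' {true}) = ENNReal.ofReal p := fun m =>
    hZ.prob _ _
  simp [this]

open Classical in
/-- The expected number of surviving words in a set `G` of words of length `n` is `p ^ n |G|`. -/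
theorem IsFractalPercolation.lintegral_card_survivors (hZ : IsFractalPercolation μ p Z) {n : ℕ}
    {G : Finset (List (Letter d M))} (hG : G ⊆ words d M n) :
    ∫⁻ ω, (({σ ∈ G | σ ∈ survivors Z n ω} : Finset _).card : ℝ≥0∞) ∂μ =
      G.card * ENNReal.ofReal p ^ n := by
  have h1 : ∀ ω, (({σ ∈ G | σ ∈ survivors Z n ω} : Finset _).card : ℝ≥0∞) =
      ∑ σ ∈ G, {ω | σ ∈ survivors Z n ω}.indicator (fun _ => 1) ω := fun ω => by
    simp [Set.indicator_apply, Finset.sum_boole]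
  simp_rw [h1]
  rw [lintegral_finsetSum _ fun σ _ =>
    measurable_const.indicator (hZ.measurableSet_survives n σ), Finset.sum_congr rfl
      (g := fun _ => ENNReal.ofReal p ^ n) fun σ hσ => ?_]
  · simp
  · rw [lintegral_indicator_const (hZ.measurableSet_survives n σ), one_mul,
      ← mem_words.1 (hG hσ), hZ.measure_survives]

/-- Everything that is determined by the cubes kept in step `n` is measurable. -/
theorem IsFractalPercolation.measurable_comp_survivors (hZ : IsFractalPercolation μ p Z) (n : ℕ)
    {β : Type*} [MeasurableSpace β] (g : Set (List (Letter d M)) → β) :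
    Measurable fun ω => g (survivors Z n ω) := by
  have hf : Measurable fun ω => fun w : words d M n => w.1 ∈ survivors Z n ω :=
    measurable_pi_iff.2 fun w => measurableSet_setOfPred.1 (hZ.measurableSet_survives n w.1)
  let G : (words d M n → Prop) → β := fun φ => g {σ | ∃ h : σ ∈ words d M n, φ ⟨σ, h⟩}
  -- The survival pattern takes finitely many values, so no regularity of `g` is needed.
  have hG : Measurable G := measurable_of_finite G
  suffices h : (fun ω => g (survivors Z n ω)) =
      G ∘ fun ω => fun w : words d M n => w.1 ∈ survivors Z n ω from h ▸ hG.comp hf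
  funext ω
  refine congrArg g ?_
  ext σ
  simp only [Set.mem_ofPred_eq, exists_prop, mem_words]
  exact ⟨fun h => ⟨(mem_survivors_iff.1 h).1, h⟩, fun h => h.2⟩

/-! ### Expected curvature of intersections of parts -/

/-- A cube under `i` contributes only if it touches a cube under `j`. The set `S` is left general to
cover both kept and discarded words. -/
theorem iInter_fiber_curvatureVar_le (hM : 0 < M) (k : Fin (d + 1)) {n : ℕ}
    (S : Set (List (Letter d M))) (hS : ∀ σ ∈ S, σ.length = n) {T : Finset (Letter d M)}
    {i j : Letter d M} (hi : i ∈ T) (hj : j ∈ T) (G : Finset (List (Letter d M)))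
    (hG : ∀ σ ∈ boundaryWords n i j, σ ∈ S → σ ∈ G) :
    curvatureVar k (⋂ l ∈ T, ⋃ σ ∈ {σ | σ ∈ S ∧ σ.head? = some l}, cube σ) ≤
      gridBound k T.card * ENNReal.ofReal (((1 / (M : ℝ)) ^ n) ^ (k : ℕ)) * G.card := by
  classical
  let R : T → Finset (List (Letter d M)) := fun l => {σ ∈ words d M n | σ ∈ S ∧ σ.head? = some l.1}
  have hset : (⋂ l ∈ T, ⋃ σ ∈ {σ | σ ∈ S ∧ σ.head? = some l}, cube σ) =
      ⋂ l : T, ⋃ σ ∈ R l, cube σ := by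
    refine (iInf_subtype' (p := (· ∈ T))
      (f := fun l _ => ⋃ σ ∈ {σ | σ ∈ S ∧ σ.head? = some l}, cube σ)).trans ?_
    refine Set.iInter_congr fun l => ?_
    refine Set.iUnion_congr fun σ => Set.iUnion_congr_Prop ?_ fun _ => rfl
    simp only [R, Finset.mem_filter, mem_words, Set.mem_ofPred_eq]
    exact ⟨fun h => ⟨hS σ h.1, h⟩, fun h => h.2⟩
  rw [hset, ← Fintype.card_coe T]
  refine curvatureVar_iInter_iUnion_cube_le hM k n R (fun _ => Finset.filter_subset _ _)
    ⟨i, hi⟩ G fun σ hσ h => ?_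
  obtain ⟨hl, hσS, hσi⟩ := Finset.mem_filter.1 hσ
  obtain ⟨τ, hτ, hτσ⟩ := h ⟨j, hj⟩
  exact hG σ (Finset.mem_filter.2 ⟨hl, hσi, τ, hτσ, (Finset.mem_filter.1 hτ).2.2⟩) hσS

/-! ### Summing the rescaled bounds -/

/-- The weight `r^(N(D-k))` compensates `M^(dN) p^N` cubes of side length `M^(-N)`. -/
theorem weight_eq (hM : 2 ≤ M) (hp0 : 0 < p) (k N : ℕ) :
    (1 / (M : ℝ)) ^ ((N : ℝ) * (percolationDim d M p - (k : ℝ))) =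
      ((M : ℝ) ^ k / ((M : ℝ) ^ d * p)) ^ N := by
  have hM0 : (0 : ℝ) < M := by positivity
  have hM1 : (M : ℝ) ≠ 1 := by
    have : (2 : ℝ) ≤ M := by exact_mod_cast hM
    linarith
  have hD : (M : ℝ) ^ percolationDim d M p = (M : ℝ) ^ d * p :=
    Real.rpow_logb hM0 hM1 (by positivity)
  rw [mul_comm, Real.rpow_mul_natCast (by positivity), one_div, Real.inv_rpow hM0.le,
    Real.rpow_sub hM0, hD, Real.rpow_natCast, inv_div]

/-- Random polyconvex sets `K n` whose expected curvature is at most `c M^(-k(n+1)) M^((d-1)(n+1))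
q^(n+1)` with `q < M p` have summable rescaled expected curvatures. -/
theorem summable_of_lintegral_curvatureVar_le (hM : 2 ≤ M) (hp0 : 0 < p) (hd : 1 ≤ d)
    (k : Fin (d + 1)) (K : ℕ → Ω → Set (Space d))
    (hK : ∀ n, Measurable fun ω => intrinsicVolume k (K n ω)) {c q : ℝ} (hq0 : 0 ≤ q) (hc : 0 ≤ c)
    (hq : q < M * p)
    (hb : ∀ n, ∫⁻ ω, curvatureVar k (K n ω) ∂μ ≤
      ENNReal.ofReal (c * ((1 / (M : ℝ)) ^ (n + 1)) ^ (k : ℕ) *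
        ((M : ℝ) ^ (n + 1)) ^ (d - 1) * q ^ (n + 1))) :
    (∑' n : ℕ, ENNReal.ofReal
        ((1 / (M : ℝ)) ^ (((n + 1 : ℕ) : ℝ) * (percolationDim d M p - ((k : ℕ) : ℝ)))) *
          ∫⁻ ω, curvatureVar k (K n ω) ∂μ) < ∞ ∧
    (∀ n : ℕ, Integrable (fun ω => intrinsicVolume k (K n ω)) μ) ∧
    Summable fun n : ℕ =>
      |(1 / (M : ℝ)) ^ (((n + 1 : ℕ) : ℝ) * (percolationDim d M p - ((k : ℕ) : ℝ))) *
        ∫ ω, intrinsicVolume k (K n ω) ∂μ| := by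
  have hM0 : (0 : ℝ) < M := by positivity
  set w : ℕ → ℝ := fun n =>
    (1 / (M : ℝ)) ^ (((n + 1 : ℕ) : ℝ) * (percolationDim d M p - ((k : ℕ) : ℝ))) with hw
  set b : ℕ → ℝ := fun n => c * ((1 / (M : ℝ)) ^ (n + 1)) ^ (k : ℕ) *
        ((M : ℝ) ^ (n + 1)) ^ (d - 1) * q ^ (n + 1) with hbdef
  have hw0 : ∀ n, 0 ≤ w n := fun n => by positivity
  have hb0 : ∀ n, 0 ≤ b n := fun n => by positivity
  -- The powers belonging to `k` cancel, and `M ^ (d - 1)` against `M ^ d` leaves one factor `1 / M`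
  -- per level.
  have hwb : ∀ n, w n * b n = c * (q / (M * p)) ^ (n + 1) := fun n => by
    simp only [hw, hbdef]
    rw [weight_eq hM hp0, one_div, inv_pow, inv_pow, ← pow_mul, ← pow_mul,
      mul_comm (n + 1) (k : ℕ), mul_comm (n + 1) (d - 1), pow_mul, pow_mul]
    obtain ⟨e, rfl⟩ : ∃ e, d = e + 1 := ⟨d - 1, by omega⟩
    rw [Nat.add_sub_cancel, div_pow, div_pow, pow_succ (M : ℝ) e, mul_pow, mul_pow, mul_pow]
    field_simp
  have hsum : Summable fun n => w n * b n := by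
    simp_rw [hwb]
    refine Summable.mul_left c ((summable_nat_add_iff 1).2
      (summable_geometric_of_lt_one (by positivity) ?_))
    rwa [div_lt_one (by positivity)]
  have hV : ∀ n ω, ‖intrinsicVolume k (K n ω)‖ₑ ≤ curvatureVar k (K n ω) := fun n ω => by
    rw [Real.enorm_eq_ofReal_abs]
    exact ENNReal.ofReal_le_of_le_toReal (abs_intrinsicVolume_le k _)
  have hlV : ∀ n, ∫⁻ ω, ‖intrinsicVolume k (K n ω)‖ₑ ∂μ ≤ ENNReal.ofReal (b n) := fun n =>
    (lintegral_mono (hV n)).trans (hb n)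
  refine ⟨?_, fun n => ⟨(hK n).aestronglyMeasurable,
    (hlV n).trans_lt ENNReal.ofReal_lt_top⟩, ?_⟩
  · refine lt_of_le_of_lt (ENNReal.tsum_le_tsum fun n => ?_) hsum.tsum_ofReal_lt_top
    rw [ENNReal.ofReal_mul (hw0 n)]
    gcongr
    exact hb n
  · refine Summable.of_nonneg_of_le (fun n => abs_nonneg _) (fun n => ?_) hsum
    rw [abs_mul, abs_of_nonneg (hw0 n)]
    refine mul_le_mul_of_nonneg_left ?_ (hw0 n)
    have h1 := (enorm_integral_le_lintegral_enorm
      (μ := μ) fun ω => intrinsicVolume k (K n ω)).trans (hlV n)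
    rwa [Real.enorm_eq_ofReal_abs, ENNReal.ofReal_le_ofReal_iff (hb0 n)] at h1

/-! ### Expectation bounds for the three kinds of intersections -/

theorem ofReal_boundary_bound (k : Fin (d + 1)) (N n : ℕ) {q : ℝ} (hq : 0 ≤ q) :
    gridBound k N * ENNReal.ofReal (((1 / (M : ℝ)) ^ n) ^ (k : ℕ)) *
      (((2 * (M ^ n) ^ (d - 1) : ℕ) : ℝ≥0∞) * ENNReal.ofReal q ^ n) =
    ENNReal.ofReal (2 * (gridBound k N).toReal * ((1 / (M : ℝ)) ^ n) ^ (k : ℕ) *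
      ((M : ℝ) ^ n) ^ (d - 1) * q ^ n) := by
  have h2 : (((2 * (M ^ n) ^ (d - 1) : ℕ) : ℝ≥0∞)) =
      ENNReal.ofReal (2 * ((M : ℝ) ^ n) ^ (d - 1)) := by
    rw [← ENNReal.ofReal_natCast]; push_cast; rfl
  rw [h2, ← ENNReal.ofReal_pow hq, ← ENNReal.ofReal_mul (by positivity),
    ← ENNReal.ofReal_toReal (gridBound_ne_top k N), ENNReal.toReal_ofReal ENNReal.toReal_nonneg,
    ← ENNReal.ofReal_mul ENNReal.toReal_nonneg, ← ENNReal.ofReal_mul (by positivity)]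
  congr 1
  ring

theorem IsFractalPercolation.lintegral_curvatureVar_approxPart_le
    (hZ : IsFractalPercolation μ p Z) (hM : 0 < M) (hp0 : 0 ≤ p) (k : Fin (d + 1))
    {T : Finset (Letter d M)} {i j : Letter d M} (hi : i ∈ T) (hj : j ∈ T) (hij : i ≠ j) (n : ℕ) :
    ∫⁻ ω, curvatureVar k (⋂ l ∈ T, approxPart Z (n + 1) l ω) ∂μ ≤
      ENNReal.ofReal (2 * (gridBound k T.card).toReal * ((1 / (M : ℝ)) ^ (n + 1)) ^ (k : ℕ) *
        ((M : ℝ) ^ (n + 1)) ^ (d - 1) * p ^ (n + 1)) := by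
  classical
  rw [← ofReal_boundary_bound k _ _ hp0]
  have h1 : ∀ ω, curvatureVar k (⋂ l ∈ T, approxPart Z (n + 1) l ω) ≤
      gridBound k T.card * ENNReal.ofReal (((1 / (M : ℝ)) ^ (n + 1)) ^ (k : ℕ)) *
        (({σ ∈ boundaryWords (n + 1) i j | σ ∈ survivors Z (n + 1) ω} : Finset _).card : ℝ≥0∞) :=
    fun ω => iInter_fiber_curvatureVar_le hM k (survivors Z (n + 1) ω)
      (fun σ hσ => (mem_survivors_iff.1 hσ).1) hi hj _
      fun σ h h' => Finset.mem_filter.2 ⟨h, h'⟩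
  refine (lintegral_mono h1).trans ?_
  rw [lintegral_const_mul' _ _ (ENNReal.mul_ne_top (gridBound_ne_top _ _) ENNReal.ofReal_ne_top),
    hZ.lintegral_card_survivors (boundaryWords_subset _ _ _)]
  gcongr
  exact card_boundaryWords_le hM n hij

/-- The number of boundary cubes is a deterministic bound, whence `1 ^ (n + 1)` in place of a power
of `p`. -/
theorem lintegral_curvatureVar_complPart_le [IsProbabilityMeasure μ]
    (Z : List (Letter d M) → Letter d M → Ω → Bool) (hM : 0 < M) (k : Fin (d + 1))
    {T : Finset (Letter d M)} {i j : Letter d M} (hi : i ∈ T) (hj : j ∈ T) (hij : i ≠ j) (n : ℕ) :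
    ∫⁻ ω, curvatureVar k (⋂ l ∈ T, complPart Z (n + 1) l ω) ∂μ ≤
      ENNReal.ofReal (2 * (gridBound k T.card).toReal * ((1 / (M : ℝ)) ^ (n + 1)) ^ (k : ℕ) *
        ((M : ℝ) ^ (n + 1)) ^ (d - 1) * 1 ^ (n + 1)) := by
  rw [← ofReal_boundary_bound k _ _ zero_le_one]
  have h1 : ∀ ω, curvatureVar k (⋂ l ∈ T, complPart Z (n + 1) l ω) ≤
      gridBound k T.card * ENNReal.ofReal (((1 / (M : ℝ)) ^ (n + 1)) ^ (k : ℕ)) *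
        ((boundaryWords (n + 1) i j).card : ℝ≥0∞) := fun ω => by
    have := iInter_fiber_curvatureVar_le hM k
      {σ | σ.length = n + 1 ∧ σ ∉ survivors Z (n + 1) ω} (fun σ hσ => hσ.1) hi hj _
      fun σ h _ => h
    simpa only [complPart, Set.mem_ofPred_eq, and_assoc] using this
  refine (lintegral_mono h1).trans ?_
  rw [lintegral_const, measure_univ, mul_one, ENNReal.ofReal_one, one_pow, mul_one]
  gcongr
  exact card_boundaryWords_le hM n hij

theorem IsFractalPercolation.lintegral_curvatureVar_iInter_approx_le {ℓ : ℕ}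
    {Z : Fin ℓ → List (Letter d M) → Letter d M → Ω → Bool} (a₀ : Fin ℓ)
    (hZ : IsFractalPercolation μ p (Z a₀)) (hM : 0 < M) (k : Fin (d + 1)) (n : ℕ) :
    ∫⁻ ω, curvatureVar k (⋂ a, approx (Z a) n ω) ∂μ ≤
      gridBound k ℓ * ENNReal.ofReal (((1 / (M : ℝ)) ^ n) ^ (k : ℕ)) *
        ((((M ^ n) ^ d : ℕ) : ℝ≥0∞) * ENNReal.ofReal p ^ n) := by
  classical
  have h1 : ∀ ω, curvatureVar k (⋂ a, approx (Z a) n ω) ≤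
      gridBound k ℓ * ENNReal.ofReal (((1 / (M : ℝ)) ^ n) ^ (k : ℕ)) *
        (({σ ∈ words d M n | σ ∈ survivors (Z a₀) n ω} : Finset _).card : ℝ≥0∞) := fun ω => by
    have h2 := curvatureVar_iInter_iUnion_cube_le hM k n
      (fun a => {σ ∈ words d M n | σ ∈ survivors (Z a) n ω})
      (fun _ => Finset.filter_subset _ _) a₀ _ fun σ h _ => h
    rw [Fintype.card_fin] at h2
    have hset : ⋂ a, approx (Z a) n ω =
        ⋂ a, ⋃ σ ∈ ({σ ∈ words d M n | σ ∈ survivors (Z a) n ω} : Finset _), cube σ := by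
      refine Set.iInter_congr fun a => Set.iUnion_congr fun σ =>
        Set.iUnion_congr_Prop ?_ fun _ => rfl
      simp only [Finset.mem_filter, mem_words]
      exact ⟨fun h => ⟨(mem_survivors_iff.1 h).1, h⟩, fun h => h.2⟩
    rw [hset]
    exact h2
  refine (lintegral_mono h1).trans ?_
  rw [lintegral_const_mul' _ _ (ENNReal.mul_ne_top (gridBound_ne_top _ _) ENNReal.ofReal_ne_top),
    hZ.lintegral_card_survivors subset_rfl]
  gcongr
  exact card_words_le d M n

end Percolation

/-! ### The three statements assembled -/

theorem mainTheorem5 (d M : ℕ) (hM : 2 ≤ M) (p : ℝ) (hp0 : 0 < p) (hp1 : p ≤ 1)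
    (k : Fin (d + 1)) :
    -- the intersection of `ℓ` independent fractal percolations
    (max ((1 / (M : ℝ)) ^ 3) ((1 / (M : ℝ)) ^ d) < p →
      ∀ ℓ : ℕ, 2 ≤ ℓ → ∃ c γ : ℝ, 0 < c ∧ 0 < γ ∧ γ < 1 ∧
        ∀ (Ω : Type*) [MeasurableSpace Ω] (μ : Measure Ω) [IsProbabilityMeasure μ]
          (Z : Fin ℓ → List (Letter d M) → Letter d M → Ω → Bool),
          (∀ a, IsFractalPercolation μ p (Z a)) →
          iIndepFun (fun (a : Fin ℓ) (ω : Ω) (w : List (Letter d M) × Letter d M) =>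
            Z a w.1 w.2 ω) μ →
          ∀ n : ℕ, 1 ≤ n →
            ∫⁻ ω, curvatureVar k (⋂ a, approx (Z a) n ω) ∂μ ≤
              ENNReal.ofReal
                (c * (1 / (M : ℝ)) ^ ((((k : ℕ) : ℤ) - (d : ℤ) - 1) * (n : ℤ)) * p ^ n * γ ^ n)) ∧
    -- the series for the approximations `F_n`
    (1 / (M : ℝ) ^ (min 3 d) < p →
      ∀ (Ω : Type*) [MeasurableSpace Ω] (μ : Measure Ω) [IsProbabilityMeasure μ]
        (Z : List (Letter d M) → Letter d M → Ω → Bool), IsFractalPercolation μ p Z →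
        ∀ T : Finset (Letter d M), 2 ≤ T.card →
          (∑' n : ℕ, ENNReal.ofReal
              ((1 / (M : ℝ)) ^ (((n + 1 : ℕ) : ℝ) * (percolationDim d M p - ((k : ℕ) : ℝ)))) *
                ∫⁻ ω, curvatureVar k (⋂ j ∈ T, approxPart Z (n + 1) j ω) ∂μ) < ∞ ∧
          (∀ n : ℕ, Integrable
            (fun ω => intrinsicVolume k (⋂ j ∈ T, approxPart Z (n + 1) j ω)) μ) ∧
          Summable fun n : ℕ =>
            |(1 / (M : ℝ)) ^ (((n + 1 : ℕ) : ℝ) * (percolationDim d M p - ((k : ℕ) : ℝ))) *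
              ∫ ω, intrinsicVolume k (⋂ j ∈ T, approxPart Z (n + 1) j ω) ∂μ|) ∧
    -- the series for the closed complements `C_n`
    (1 / (M : ℝ) < p →
      ∀ (Ω : Type*) [MeasurableSpace Ω] (μ : Measure Ω) [IsProbabilityMeasure μ]
        (Z : List (Letter d M) → Letter d M → Ω → Bool), IsFractalPercolation μ p Z →
        ∀ T : Finset (Letter d M), 2 ≤ T.card →
          (∑' n : ℕ, ENNReal.ofReal
              ((1 / (M : ℝ)) ^ (((n + 1 : ℕ) : ℝ) * (percolationDim d M p - ((k : ℕ) : ℝ)))) *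
                ∫⁻ ω, curvatureVar k (⋂ j ∈ T, complPart Z (n + 1) j ω) ∂μ) < ∞ ∧
          (∀ n : ℕ, Integrable
            (fun ω => intrinsicVolume k (⋂ j ∈ T, complPart Z (n + 1) j ω)) μ) ∧
          Summable fun n : ℕ =>
            |(1 / (M : ℝ)) ^ (((n + 1 : ℕ) : ℝ) * (percolationDim d M p - ((k : ℕ) : ℝ))) *
              ∫ ω, intrinsicVolume k (⋂ j ∈ T, complPart Z (n + 1) j ω) ∂μ|) := by
  have hM0 : 0 < M := by omega
  have hMR : (2 : ℝ) ≤ M := by exact_mod_cast hM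
  refine ⟨fun _ ℓ hℓ => ?_, fun _ Ω _ μ _ Z hZ T hT => ?_, fun hp Ω _ μ _ Z hZ T hT => ?_⟩
  -- Adding `1` makes the constant visibly positive; `γ = 1 / M` absorbs the extra `-1` in the
  -- exponent `k - d - 1`.
  · refine ⟨(gridBound k ℓ).toReal + 1, 1 / M, by positivity, by positivity, ?_,
      fun Ω _ μ _ Z hZ _ n _ => ?_⟩
    · rw [div_lt_one (by linarith)]
      linarith
    refine (IsFractalPercolation.lintegral_curvatureVar_iInter_approx_le
      (⟨0, by omega⟩ : Fin ℓ) (hZ _) hM0 k n).trans ?_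
    have h1 : (((M ^ n) ^ d : ℕ) : ℝ≥0∞) = ENNReal.ofReal (((M : ℝ) ^ n) ^ d) := by
      rw [← ENNReal.ofReal_natCast]; push_cast; rfl
    rw [h1, ← ENNReal.ofReal_toReal (gridBound_ne_top k ℓ), ← ENNReal.ofReal_pow hp0.le,
      ENNReal.toReal_ofReal ENNReal.toReal_nonneg, ← ENNReal.ofReal_mul ENNReal.toReal_nonneg,
      ← ENNReal.ofReal_mul (by positivity), ← ENNReal.ofReal_mul (by positivity)]
    have hr : (1 / (M : ℝ)) ^ ((((k : ℕ) : ℤ) - (d : ℤ) - 1) * (n : ℤ)) * (1 / (M : ℝ)) ^ n =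
        ((1 / (M : ℝ)) ^ n) ^ (k : ℕ) * ((M : ℝ) ^ n) ^ d := by
      have hMne : (M : ℝ) ≠ 0 := by positivity
      rw [zpow_mul, zpow_natCast, zpow_sub₀ (by positivity), zpow_sub₀ (by positivity), zpow_one,
        zpow_natCast, zpow_natCast, ← mul_pow, div_mul_cancel₀ _ (by positivity), div_pow,
        one_div, inv_pow, inv_pow, inv_pow, div_eq_mul_inv, inv_pow, inv_inv, ← pow_mul, ← pow_mul,
        ← pow_mul, ← pow_mul, mul_comm n, mul_comm n, inv_pow]
    refine ENNReal.ofReal_le_ofReal ?_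
    calc (gridBound k ℓ).toReal * ((1 / (M : ℝ)) ^ n) ^ (k : ℕ) * (((M : ℝ) ^ n) ^ d * p ^ n)
        ≤ ((gridBound k ℓ).toReal + 1) *
          ((((1 / (M : ℝ)) ^ n) ^ (k : ℕ) * ((M : ℝ) ^ n) ^ d) * p ^ n) := by
          rw [mul_assoc, ← mul_assoc (((1 / (M : ℝ)) ^ n) ^ (k : ℕ))]
          gcongr
          linarith
      _ = _ := by rw [← hr]; ring
  · obtain ⟨i, hi, j, hj, hij⟩ := Finset.one_lt_card.1 hT
    -- Two distinct labels need a coordinate in which to differ, which gives `1 ≤ d`.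
    obtain ⟨a, -⟩ : ∃ a, i a ≠ j a := Function.ne_iff.1 hij
    have hmeas : ∀ n, Measurable fun ω =>
        intrinsicVolume k (⋂ j ∈ T, approxPart Z (n + 1) j ω) := fun n =>
      hZ.measurable_comp_survivors (n + 1) fun S => intrinsicVolume k
        (⋂ j ∈ T, ⋃ σ ∈ {σ | σ ∈ S ∧ σ.head? = some j}, cube σ)
    exact summable_of_lintegral_curvatureVar_le hM hp0 a.pos k
      (fun n ω => ⋂ j ∈ T, approxPart Z (n + 1) j ω) hmeas hp0.le (by positivity)
      (by nlinarith) (hZ.lintegral_curvatureVar_approxPart_le hM0 hp0.le k hi hj hij)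
  · obtain ⟨i, hi, j, hj, hij⟩ := Finset.one_lt_card.1 hT
    obtain ⟨a, -⟩ : ∃ a, i a ≠ j a := Function.ne_iff.1 hij
    have hmeas : ∀ n, Measurable fun ω =>
        intrinsicVolume k (⋂ j ∈ T, complPart Z (n + 1) j ω) := fun n =>
      hZ.measurable_comp_survivors (n + 1) (g := fun S => intrinsicVolume k
        (⋂ j ∈ T, ⋃ σ ∈ {σ | List.length σ = n + 1 ∧ σ ∉ S ∧ σ.head? = some j}, cube σ))
    refine summable_of_lintegral_curvatureVar_le hM hp0 a.pos k
      (fun n ω => ⋂ j ∈ T, complPart Z (n + 1) j ω) hmeas zero_le_one (by positivity) ?_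
      (lintegral_curvatureVar_complPart_le Z hM0 k hi hj hij)
    rwa [div_lt_iff₀ (by linarith), mul_comm] at hp
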